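/- Let $A\in\mathbb R^{m\times n}$, $q\in\mathbb R^n$, and let $h:\mathbb R^m\to(-\infty,\infty]$ be closed (lower semicontinuous), proper and convex, such that $\operatorname{dom}h=\{y: h(y)<\infty\}$ is open, $h$ is continuously differentiable on $\operatorname{dom} h$, and $h$ is strongly convex on every compact convex subset of $\operatorname{dom}h$. Let $f(x)=h(Ax)+\langle q,x\rangle$ be proper, with gradient $\nabla f$ Lipschitz continuous with constant $L>0$ on $\operatorname{dom}f$. Let $g$ be the group LASSO regularizer $g(x)=\sum_{J\in\mathcal J}\omega_J\|x_J\|_2$, where $\mathcal J$ is a partition of $\{1,\dots,n\}$ and $\omega_J\ge 0$, and let $F=f+g$. Suppose that the set $\mathcal X=\operatorname{argmin}_{\mathbb R^n}F$ of optimal solutions is nonempty (it need not be compact), and let $0<\gamma<1/L$. Let $\{x^k\}_{k\ge0}$ be any sequence in $\mathbb R^n$ generated by the proximal gradient method $$x^{k+1}\in\operatorname*{arg\,min}_{z\in\mathbb R^n}\Big\{g(z)+\tfrac1{2\gamma}\big\|z-\big(x^k-\gamma\nabla f(x^k)\big)\big\|^2\Big\},\qquad k\ge 0.$$ Then $\{x^k\}$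 converges linearly to an optimal solution: there exist $\bar x\in\mathcal X$, an index $k_0$, and constants $\sigma,\rho\in(0,1)$, $\rho_0>0$ such that for all $k\ge k_0$, $$F(x^{k+1})-F(\bar x)\le\sigma\,\big(F(x^k)-F(\bar x)\big)\qquad\text{and}\qquad \|x^k-\bar x\|\le\rho_0\,\rho^k .$$ -/

import Mathlib

namespace ProxGrad

open Set

/-- Effective domain of an extended-real-valued function. -/
def effDom {E : Type*} (φ : E → EReal) : Set E := {x | φ x < ⊤}

/-- `φ` takes values in `(-∞, ∞]` and is not identically `∞`. -/
def Proper {E : Type*} (φ : E → EReal) : Prop :=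
  (∀ x, φ x ≠ ⊥) ∧ (effDom φ).Nonempty

/-- Convexity of an extended-real-valued function: its epigraph is a convex set. -/
def ConvexFun {E : Type*} [AddCommGroup E] [Module ℝ E] (φ : E → EReal) : Prop :=
  Convex ℝ {p : E × ℝ | φ p.1 ≤ (p.2 : EReal)}

/-- Gradient of an extended-real-valued function; meaningful at interior points of `effDom φ`
where the (there real-valued) function is differentiable. -/
noncomputable def grad {E : Type*} [NormedAddCommGroup E] [InnerProductSpace ℝ E]
    [CompleteSpace E] (φ : E → EReal) (x : E) : E :=
  gradient (fun z => (φ z).toReal) x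

/-- The requirements on the outer function `h`: closed, proper, convex, with open domain on which
it is continuously differentiable, and strongly convex on each compact convex subset of the
domain. -/
structure LocallyStronglyConvex {m : ℕ} (h : EuclideanSpace ℝ (Fin m) → EReal) : Prop where
  proper : Proper h
  closed : LowerSemicontinuous h
  convex : ConvexFun h
  isOpen_dom : IsOpen (effDom h)
  contDiffOn : ContDiffOn ℝ 1 (fun y => (h y).toReal) (effDom h)
  strongConvexOn : ∀ K : Set (EuclideanSpace ℝ (Fin m)), K ⊆ effDom h → IsCompact K →
    Convex ℝ K → ∃ c : ℝ, 0 < c ∧ StrongConvexOn K c (fun y => (h y).toReal)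

/-- The structured function `f(x) = h(Ax) + ⟨q, x⟩`. -/
noncomputable def structuredFun {m n : ℕ} (h : EuclideanSpace ℝ (Fin m) → EReal)
    (A : Matrix (Fin m) (Fin n) ℝ) (q : EuclideanSpace ℝ (Fin n)) :
    EuclideanSpace ℝ (Fin n) → EReal :=
  fun x => h (WithLp.toLp 2 (A.mulVec x.ofLp)) + ((inner ℝ q x : ℝ) : EReal)

/-- The group LASSO regularizer `∑ J ∈ 𝒥, ω_J ‖x_J‖₂` of a partition `𝒥` of the index set. -/
noncomputable def groupLasso {n : ℕ} (𝒥 : Finpartition (Finset.univ : Finset (Fin n)))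
    (ω : Finset (Fin n) → ℝ) (x : EuclideanSpace ℝ (Fin n)) : ℝ :=
  ∑ J ∈ 𝒥.parts, ω J * Real.sqrt (∑ i ∈ J, x i ^ 2)

/-- The proximal operator `argmin_z { g(z) + ‖z - a‖² / (2γ) }` (a set of points) of a
real-valued function `g`. -/
def prox {E : Type*} [NormedAddCommGroup E] (g : E → ℝ) (γ : ℝ) (a : E) : Set E :=
  {x | ∀ z, g x + 1 / (2 * γ) * ‖x - a‖ ^ 2 ≤ g z + 1 / (2 * γ) * ‖z - a‖ ^ 2}

/-- `x` is generated by the proximal gradient method with step size `γ` for `f + g`. -/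
def IsPGSequence {E : Type*} [NormedAddCommGroup E] [InnerProductSpace ℝ E] [CompleteSpace E]
    (f : E → EReal) (g : E → ℝ) (γ : ℝ) (x : ℕ → E) : Prop :=
  ∀ k, x (k + 1) ∈ prox g γ (x k - γ • grad f (x k))

/-- The set of optimal solutions (global minimizers) of an extended-real-valued function. -/
def optSet {E : Type*} (F : E → EReal) : Set E := {x | ∀ z, F x ≤ F z}

/-- `x` converges to `xbar` linearly: eventually the objective gaps contract by a fixed factor
in `(0, 1)` in each step, and the distances to `xbar` are bounded by a geometric sequence. -/
def ConvergesLinearly {E : Type*} [NormedAddCommGroup E]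
    (F : E → EReal) (x : ℕ → E) (xbar : E) : Prop :=
  ∃ k₀ : ℕ,
    (∃ σ : ℝ, 0 < σ ∧ σ < 1 ∧ ∀ k, k₀ ≤ k →
      F (x (k + 1)) - F xbar ≤ (σ : EReal) * (F (x k) - F xbar)) ∧
    (∃ ρ₀ ρ : ℝ, 0 < ρ₀ ∧ 0 < ρ ∧ ρ < 1 ∧ ∀ k, k₀ ≤ k → ‖x k - xbar‖ ≤ ρ₀ * ρ ^ k)

end ProxGrad

/-! Linear convergence follows from quadratic growth of `F` on bounded sets: `c * dist² ≤ F - min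
F`. This suffices because each proximal gradient step moves no farther from any given minimizer, so
the iterates stay in one ball even when the solution set is unbounded.

For the growth, fix a minimizer `x₀` and put `w = -∇f(x₀)`, a subgradient of `g` at `x₀`. Every `y`
with `A y = A x₀` in the face `{g = ⟪w, ·⟫}` is optimal. The gap `F u - F x₀` dominates `g u - ⟪w,
u⟫` plus a multiple of `‖A (u - x₀)‖²`, by strong convexity of `h` on the image of a ball. The first
term controls the squared distance to the face (`exists_sq_norm_sub_blockParam_le`). The face need
not be polyhedral as the zero set of a norm gap suggests, yet it is: on each block it is a ray, a
point or the whole space. Hence it has a linear parametrization with sign constraints, and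
`hoffman_box` moves a point of the face to one with `A y = A x₀` at a cost linear in the residual.

Also, `f` is finite everywhere: a Lipschitz gradient bounds `f` quadratically on its domain, while
closedness and openness of `dom h` force blow-up at a boundary point (`effDom_eq_univ`). -/

namespace ProxGrad

open Set

/-! ### Hoffman's error bound under box constraints -/

/-- A linear map that vanishes only at the origin of an orthant face is bounded below there. -/
lemma exists_norm_le_of_orthant {ι E : Type*} [Fintype ι] [NormedAddCommGroup E]
    [NormedSpace ℝ E] (M : (ι → ℝ) →ₗ[ℝ] E) (σ : ι → SignType)
    (hM : ∀ d : ι → ℝ, (∀ i, (σ i : ℝ) * d i = |d i|) → M d = 0 → d = 0) :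
    ∃ κ : ℝ, 0 ≤ κ ∧ ∀ d : ι → ℝ, (∀ i, (σ i : ℝ) * d i = |d i|) → ‖d‖ ≤ κ * ‖M d‖ := by
  have hc : Continuous M := M.continuous_of_finiteDimensional
  set K : Set (ι → ℝ) := {d | ∀ i, (σ i : ℝ) * d i = |d i|} with hK
  have hKc : IsClosed K := by
    rw [hK, ofPred_forall]
    exact isClosed_iInter fun i => isClosed_eq (by fun_prop) (by fun_prop)
  have hS : IsCompact (Metric.sphere (0 : ι → ℝ) 1 ∩ K) := (isCompact_sphere _ _).inter_right hKc
  have hnorm : ∀ d ∈ K, d ≠ 0 → ‖d‖⁻¹ • d ∈ Metric.sphere (0 : ι → ℝ) 1 ∩ K := by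
    intro d hd h0
    refine ⟨by simp [norm_smul, h0], fun i => ?_⟩
    simp only [Pi.smul_apply, smul_eq_mul, abs_mul, abs_inv, abs_norm]
    rw [← hd i]; ring
  rcases (Metric.sphere (0 : ι → ℝ) 1 ∩ K).eq_empty_or_nonempty with he | hne
  · refine ⟨0, le_rfl, fun d hd => ?_⟩
    by_cases h0 : d = 0
    · simp [h0]
    · have := hnorm d hd h0
      simp [he] at this
  -- By homogeneity, the inverse of the minimum of `‖M ·‖` over the unit vectors of the cone serves
  -- as `κ`.
  · obtain ⟨e, he, hmin⟩ := hS.exists_isMinOn hne hc.norm.continuousOn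
    have hpos : 0 < ‖M e‖ := by
      rw [norm_pos_iff]
      intro h
      have := hM e he.2 h
      have h1 := he.1
      simp [this] at h1
    refine ⟨‖M e‖⁻¹, by positivity, fun d hd => ?_⟩
    by_cases h0 : d = 0
    · simp [h0]
    · have h1 := hmin (hnorm d hd h0)
      simp only [mem_ofPred_eq, map_smul, norm_smul, norm_inv, norm_norm] at h1
      have hd0 : 0 < ‖d‖ := norm_pos_iff.2 h0
      rw [inv_mul_eq_div, le_div_iff₀ hd0] at h1
      rw [inv_mul_eq_div, le_div_iff₀ hpos]
      linarith

/-- A kernel element can be split off so that the remainder, which stays between `0` and `d`,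
has no kernel elements in its own orthant face. -/
lemma exists_reduced {ι E : Type*} [Fintype ι] [NormedAddCommGroup E]
    [NormedSpace ℝ E] (M : (ι → ℝ) →ₗ[ℝ] E) (d : ι → ℝ) :
    ∃ d' : ι → ℝ, M d' = M d ∧ (∀ i, d' i ∈ uIcc 0 (d i)) ∧
      ∀ e : ι → ℝ, (∀ i, (SignType.sign (d' i) : ℝ) * e i = |e i|) → M e = 0 → e = 0 := by
  have hc : Continuous M := M.continuous_of_finiteDimensional
  set Z : Set (ι → ℝ) := (univ.pi fun i => uIcc 0 (d i)) ∩ {z | M z = 0} with hZ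
  have hZc : IsCompact Z :=
    (isCompact_univ_pi fun i => isCompact_uIcc).inter_right
      (isClosed_eq hc continuous_const)
  have hZn : Z.Nonempty := ⟨0, fun _ _ => left_mem_uIcc, map_zero M⟩
  -- Take the kernel element of the box with largest ℓ¹ norm. A kernel vector `e` with the signs of
  -- `d - z` could be added to `z` in a small multiple: this stays in the box and, as `z` and `d -
  -- z` have compatible signs, raises the ℓ¹ norm by `ε * ∑ |e i|`. So `e = 0`.
  obtain ⟨z, ⟨hz1, hz2⟩, hmax⟩ := hZc.exists_isMaxOn hZn
    (f := fun z : ι → ℝ => ∑ i, |z i|) (by fun_prop)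
  have hzi : ∀ i, z i ∈ uIcc 0 (d i) := fun i => hz1 i (mem_univ i)
  refine ⟨d - z, by simp [map_sub, show M z = 0 from hz2], fun i => ?_, fun e he hMe => ?_⟩
  · have := hzi i
    rw [mem_uIcc] at this ⊢
    simp only [Pi.sub_apply]
    rcases this with h | h
    · left; constructor <;> linarith
    · right; constructor <;> linarith
  · have hev : ∀ᶠ ε : ℝ in nhdsWithin 0 (Ioi 0), ∀ i, ε * |e i| ≤ |d i - z i| := by
      rw [Filter.eventually_all]
      intro i
      by_cases h0 : d i - z i = 0
      · have := he i
        simp only [Pi.sub_apply, h0, sign_zero, SignType.coe_zero, zero_mul] at this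
        simp [← this]
      · have : Filter.Tendsto (fun ε : ℝ => ε * |e i|) (nhdsWithin 0 (Ioi 0)) (nhds (0 * |e i|)) :=
          ((continuous_id.mul continuous_const).tendsto' _ _ rfl).mono_left nhdsWithin_le_nhds
        rw [zero_mul] at this
        exact (this.eventually_lt_const (abs_pos.2 h0)).mono fun _ h => h.le
    obtain ⟨ε, hε, hε0⟩ := (hev.and self_mem_nhdsWithin).exists
    have hε0 : 0 < ε := hε0
    have key : ∀ i, z i + ε * e i ∈ uIcc 0 (d i) ∧ |z i + ε * e i| = |z i| + ε * |e i| := by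
      intro i
      have h1 := hε i
      have h2 := he i
      have h3 := hzi i
      simp only [Pi.sub_apply] at h2
      rw [mem_uIcc] at h3 ⊢
      rcases lt_trichotomy (d i - z i) 0 with h | h | h
      · rw [sign_neg h] at h2
        simp only [SignType.coe_neg_one] at h2
        have h4 : e i ≤ 0 := by have := abs_nonneg (e i); linarith
        have h5 : z i ≤ 0 := by rcases h3 with h3 | h3 <;> linarith
        have h6 : ε * e i ≤ 0 := mul_nonpos_of_nonneg_of_nonpos hε0.le h4
        rw [abs_of_neg h, abs_of_nonpos h4] at h1
        refine ⟨Or.inr ⟨by linarith, by linarith⟩, ?_⟩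
        rw [abs_of_nonpos h4, abs_of_nonpos h5, abs_of_nonpos (by linarith)]
        ring
      · rw [h] at h2
        simp only [sign_zero, SignType.coe_zero, zero_mul] at h2
        have h4 : e i = 0 := abs_eq_zero.1 h2.symm
        simpa [h4] using h3
      · rw [sign_pos h] at h2
        simp only [SignType.coe_one] at h2
        have h4 : 0 ≤ e i := by have := abs_nonneg (e i); linarith
        have h5 : 0 ≤ z i := by rcases h3 with h3 | h3 <;> linarith
        have h6 : 0 ≤ ε * e i := mul_nonneg hε0.le h4
        rw [abs_of_pos h, abs_of_nonneg h4] at h1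
        refine ⟨Or.inl ⟨by linarith, by linarith⟩, ?_⟩
        rw [abs_of_nonneg h4, abs_of_nonneg h5, abs_of_nonneg (by linarith)]
    have hmem : z + ε • e ∈ Z :=
      ⟨fun i _ => (key i).1, by simp [hMe, show M z = 0 from hz2]⟩
    have h1 := hmax hmem
    simp only [mem_ofPred_eq, Pi.add_apply, Pi.smul_apply, smul_eq_mul] at h1
    rw [Finset.sum_congr rfl fun i _ => (key i).2, Finset.sum_add_distrib, ← Finset.mul_sum] at h1
    have h2 : ∑ i, |e i| ≤ 0 := by
      by_contra h
      push Not at h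
      have := mul_pos hε0 h
      linarith
    have h3 : ∑ i, |e i| = 0 := le_antisymm h2 (Finset.sum_nonneg fun i _ => abs_nonneg _)
    rw [Finset.sum_eq_zero_iff_of_nonneg fun i _ => abs_nonneg _] at h3
    ext i
    exact abs_eq_zero.1 (h3 i (Finset.mem_univ i))

/-- Hoffman's error bound for a linear system under box constraints: a solution of `M t' = M t₀`
can be found coordinatewise between `t` and `t₀`, at a distance from `t` controlled by the
residual. -/
theorem hoffman_box {ι E : Type*} [Fintype ι] [NormedAddCommGroup E]
    [NormedSpace ℝ E] (M : (ι → ℝ) →ₗ[ℝ] E) :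
    ∃ κ : ℝ, 0 ≤ κ ∧ ∀ t t₀ : ι → ℝ, ∃ t' : ι → ℝ, M t' = M t₀ ∧
      (∀ i, t' i ∈ uIcc (t i) (t₀ i)) ∧ ‖t - t'‖ ≤ κ * ‖M t - M t₀‖ := by
  classical
  have h1 : ∀ σ : ι → SignType, ∃ κ : ℝ, 0 ≤ κ ∧
      ((∀ d : ι → ℝ, (∀ i, (σ i : ℝ) * d i = |d i|) → M d = 0 → d = 0) →
        ∀ d : ι → ℝ, (∀ i, (σ i : ℝ) * d i = |d i|) → ‖d‖ ≤ κ * ‖M d‖) := by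
    intro σ
    by_cases h : ∀ d : ι → ℝ, (∀ i, (σ i : ℝ) * d i = |d i|) → M d = 0 → d = 0
    · obtain ⟨κ, h0, hκ⟩ := exists_norm_le_of_orthant M σ h
      exact ⟨κ, h0, fun _ => hκ⟩
    · exact ⟨0, le_rfl, fun h' => absurd h' h⟩
  choose κ hκ0 hκ using h1
  -- There are finitely many sign patterns, so the sum bounds every `κ σ`; patterns whose face meets
  -- the kernel nontrivially do not occur for a reduced displacement.
  refine ⟨∑ σ, κ σ, Finset.sum_nonneg fun σ _ => hκ0 σ, fun t t₀ => ?_⟩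
  obtain ⟨d, hd1, hd2, hd3⟩ := exists_reduced M (t₀ - t)
  refine ⟨t + d, by simp [hd1], fun i => ?_, ?_⟩
  · have := hd2 i
    rw [mem_uIcc] at this ⊢
    simp only [Pi.sub_apply] at this
    simp only [Pi.add_apply]
    rcases this with h | h
    · left; constructor <;> linarith
    · right; constructor <;> linarith
  · have h2 := hκ (fun i => SignType.sign (d i)) hd3 d fun i => sign_mul_self (d i)
    rw [hd1, map_sub, norm_sub_rev] at h2
    rw [sub_add_cancel_left, norm_neg]
    refine h2.trans (mul_le_mul_of_nonneg_right ?_ (norm_nonneg _))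
    exact Finset.single_le_sum (fun σ _ => hκ0 σ) (Finset.mem_univ _)

/-! ### Faces of the group norm -/

/-- Growth of `ω‖x‖ - ⟪w, x⟫` away from its zero set, on a ball. -/
lemma exists_sq_norm_sub_le_norm_sub_inner {E : Type*} [NormedAddCommGroup E]
    [InnerProductSpace ℝ E] (w : E) (ω R : ℝ) (hw : ‖w‖ ≤ ω) (hR : 0 ≤ R) :
    ∃ κ : ℝ, 0 ≤ κ ∧ ∀ x : E, ‖x‖ ≤ R →
      ‖x - ((if ‖w‖ = ω ∧ 0 < ω then ‖x‖ / ω else 0) • w + (if ω = 0 then x else 0))‖ ^ 2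
        ≤ κ * (ω * ‖x‖ - inner ℝ w x) := by
  have hω : 0 ≤ ω := (norm_nonneg w).trans hw
  rcases hω.eq_or_lt with h0 | h0
  · subst h0
    exact ⟨0, le_rfl, fun x _ => by simp⟩
  · rcases hw.eq_or_lt with h1 | h1
    · refine ⟨2 * R / ω, by positivity, fun x hx => ?_⟩
      have h2 : 0 ≤ ω * ‖x‖ - inner ℝ w x := by
        have := real_inner_le_norm w x
        rw [h1] at this
        linarith
      -- The comparison point is the multiple of `w` with the same norm as `x`; the squared distance
      -- is then exactly proportional to the gap, with a factor bounded on the ball.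
      have h3 : ‖x - (‖x‖ / ω) • w‖ ^ 2 = (2 * ‖x‖ / ω) * (ω * ‖x‖ - inner ℝ w x) := by
        rw [norm_sub_sq_real, norm_smul, inner_smul_right, real_inner_comm, h1,
          Real.norm_of_nonneg (by positivity)]
        field_simp
        ring
      simp only [h1, h0, h0.ne', and_self, if_true, if_false, add_zero]
      rw [h3]
      gcongr
    · refine ⟨R / (ω - ‖w‖), div_nonneg hR (by linarith), fun x hx => ?_⟩
      have h2 : (ω - ‖w‖) * ‖x‖ ≤ ω * ‖x‖ - inner ℝ w x := by
        have := real_inner_le_norm w x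
        linarith
      have h3 : 0 < ω - ‖w‖ := by linarith
      simp only [h1.ne, h0.ne', false_and, if_false, zero_smul, add_zero, sub_zero]
      calc ‖x‖ ^ 2 ≤ R * ‖x‖ := by rw [sq]; gcongr
        _ = R / (ω - ‖w‖) * ((ω - ‖w‖) * ‖x‖) := by field_simp
        _ ≤ _ := by gcongr

/-- The restriction of a vector to a block of coordinates, extended by zero. -/
noncomputable def blockProj {n : ℕ} (J : Finset (Fin n)) :
    EuclideanSpace ℝ (Fin n) →ₗ[ℝ] EuclideanSpace ℝ (Fin n) where
  toFun x := WithLp.toLp 2 fun i => if i ∈ J then x i else 0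
  map_add' x y := by ext i; by_cases h : i ∈ J <;> simp [h]
  map_smul' c x := by ext i; by_cases h : i ∈ J <;> simp [h]

lemma blockProj_apply {n : ℕ} (J : Finset (Fin n)) (x : EuclideanSpace ℝ (Fin n)) (i : Fin n) :
    blockProj J x i = if i ∈ J then x i else 0 := rfl

lemma norm_blockProj {n : ℕ} (J : Finset (Fin n)) (x : EuclideanSpace ℝ (Fin n)) :
    ‖blockProj J x‖ = Real.sqrt (∑ i ∈ J, x i ^ 2) := by
  rw [EuclideanSpace.norm_eq]
  simp [blockProj_apply, apply_ite, Finset.sum_ite_mem]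

lemma norm_blockProj_le {n : ℕ} (J : Finset (Fin n)) (x : EuclideanSpace ℝ (Fin n)) :
    ‖blockProj J x‖ ≤ ‖x‖ := by
  rw [norm_blockProj, EuclideanSpace.norm_eq]
  refine Real.sqrt_le_sqrt ?_
  simp only [Real.norm_eq_abs, sq_abs]
  exact Finset.sum_le_sum_of_subset_of_nonneg (Finset.subset_univ _) fun i _ _ => sq_nonneg _

lemma sum_parts {n : ℕ} (𝒥 : Finpartition (Finset.univ : Finset (Fin n))) (a : Fin n → ℝ) :
    ∑ J ∈ 𝒥.parts, ∑ i ∈ J, a i = ∑ i, a i := by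
  have h := Finset.sum_biUnion (f := a) (t := id) 𝒥.disjoint
  rw [← Finset.sup_eq_biUnion, 𝒥.sup_parts] at h
  exact h.symm

lemma inner_blockProj {n : ℕ} (J : Finset (Fin n)) (w x : EuclideanSpace ℝ (Fin n)) :
    inner ℝ (blockProj J w) (blockProj J x) = ∑ i ∈ J, w i * x i := by
  simp only [PiLp.inner_apply, blockProj_apply]
  simp [Finset.sum_ite_mem, ite_mul, mul_comm]

lemma sum_inner_blockProj {n : ℕ} (𝒥 : Finpartition (Finset.univ : Finset (Fin n)))
    (w x : EuclideanSpace ℝ (Fin n)) :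
    ∑ J ∈ 𝒥.parts, inner ℝ (blockProj J w) (blockProj J x) = inner ℝ w x := by
  simp only [inner_blockProj, sum_parts]
  simp [PiLp.inner_apply, mul_comm]

lemma sum_norm_blockProj_sq {n : ℕ} (𝒥 : Finpartition (Finset.univ : Finset (Fin n)))
    (x : EuclideanSpace ℝ (Fin n)) :
    ∑ J ∈ 𝒥.parts, ‖blockProj J x‖ ^ 2 = ‖x‖ ^ 2 := by
  simp only [← real_inner_self_eq_norm_sq, sum_inner_blockProj]

lemma groupLasso_eq {n : ℕ} (𝒥 : Finpartition (Finset.univ : Finset (Fin n)))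
    (ω : Finset (Fin n) → ℝ) (x : EuclideanSpace ℝ (Fin n)) :
    groupLasso 𝒥 ω x = ∑ J ∈ 𝒥.parts, ω J * ‖blockProj J x‖ := by
  simp only [groupLasso, norm_blockProj]

lemma groupLasso_smul {n : ℕ} (𝒥 : Finpartition (Finset.univ : Finset (Fin n)))
    (ω : Finset (Fin n) → ℝ) (c : ℝ) (x : EuclideanSpace ℝ (Fin n)) :
    groupLasso 𝒥 ω (c • x) = |c| * groupLasso 𝒥 ω x := by
  simp only [groupLasso_eq, map_smul, norm_smul, Finset.mul_sum, Real.norm_eq_abs]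
  exact Finset.sum_congr rfl fun _ _ => by ring

lemma groupLasso_convexOn {n : ℕ} (𝒥 : Finpartition (Finset.univ : Finset (Fin n)))
    (ω : Finset (Fin n) → ℝ) (hω : ∀ J ∈ 𝒥.parts, 0 ≤ ω J) :
    ConvexOn ℝ univ (groupLasso 𝒥 ω) := by
  refine ⟨convex_univ, fun x _ y _ a b ha hb hab => ?_⟩
  simp only [groupLasso_eq, smul_eq_mul, Finset.mul_sum, ← Finset.sum_add_distrib]
  refine Finset.sum_le_sum fun J hJ => ?_
  have h1 : ‖blockProj J (a • x + b • y)‖ ≤ a * ‖blockProj J x‖ + b * ‖blockProj J y‖ := by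
    rw [map_add, map_smul, map_smul]
    refine (norm_add_le _ _).trans_eq ?_
    rw [norm_smul, norm_smul, Real.norm_of_nonneg ha, Real.norm_of_nonneg hb]
  calc _ ≤ ω J * (a * ‖blockProj J x‖ + b * ‖blockProj J y‖) :=
        mul_le_mul_of_nonneg_left h1 (hω J hJ)
    _ = _ := by ring

lemma continuous_groupLasso {n : ℕ} (𝒥 : Finpartition (Finset.univ : Finset (Fin n)))
    (ω : Finset (Fin n) → ℝ) : Continuous (groupLasso 𝒥 ω) := by
  unfold groupLasso
  fun_prop

/-- A dual vector below the group norm lies blockwise in the ball of radius `ω J`. -/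
lemma norm_blockProj_le_of_inner_le {n : ℕ} {𝒥 : Finpartition (Finset.univ : Finset (Fin n))}
    {ω : Finset (Fin n) → ℝ} {w : EuclideanSpace ℝ (Fin n)}
    (hω : ∀ J ∈ 𝒥.parts, 0 ≤ ω J)
    (hw : ∀ z, inner ℝ w z ≤ groupLasso 𝒥 ω z) {J : Finset (Fin n)} (hJ : J ∈ 𝒥.parts) :
    ‖blockProj J w‖ ≤ ω J := by
  have h1 := hw (blockProj J w)
  have h2 : inner ℝ w (blockProj J w) = ‖blockProj J w‖ ^ 2 := by
    rw [← real_inner_self_eq_norm_sq, inner_blockProj]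
    simp [PiLp.inner_apply, blockProj_apply, mul_comm]
  have h3 : groupLasso 𝒥 ω (blockProj J w) = ω J * ‖blockProj J w‖ := by
    rw [groupLasso_eq, Finset.sum_eq_single_of_mem J hJ]
    · congr 2
      ext i
      by_cases h : i ∈ J <;> simp [blockProj_apply, h]
    · intro K hK hKJ
      have hd : Disjoint K J := 𝒥.disjoint hK hJ hKJ
      have : blockProj K (blockProj J w) = 0 := by
        ext i
        by_cases h : i ∈ K
        · simp [blockProj_apply, h, Finset.disjoint_left.1 hd h]
        · simp [blockProj_apply, h]
      simp [this]
  rw [h2, h3, sq] at h1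
  rcases (norm_nonneg (blockProj J w)).eq_or_lt with h | h
  · rw [← h]; exact hω J hJ
  · exact le_of_mul_le_mul_right h1 h

/-- Parametrization of the set where a dual vector `w` attains the group norm: a multiple of `w`
on each block, plus an arbitrary vector. -/
noncomputable def blockParam {n : ℕ} (𝒥 : Finpartition (Finset.univ : Finset (Fin n)))
    (w : EuclideanSpace ℝ (Fin n)) :
    (Finset (Fin n) ⊕ Fin n → ℝ) →ₗ[ℝ] EuclideanSpace ℝ (Fin n) where
  toFun p := WithLp.toLp 2 fun i => p (Sum.inl (𝒥.part i)) * w i + p (Sum.inr i)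
  map_add' p r := by ext i; simp; ring
  map_smul' c p := by ext i; simp; ring

lemma blockProj_blockParam {n : ℕ} (𝒥 : Finpartition (Finset.univ : Finset (Fin n)))
    (w : EuclideanSpace ℝ (Fin n)) (p : Finset (Fin n) ⊕ Fin n → ℝ)
    {J : Finset (Fin n)} (hJ : J ∈ 𝒥.parts) :
    blockProj J (blockParam 𝒥 w p) =
      p (Sum.inl J) • blockProj J w + blockProj J (WithLp.toLp 2 fun i => p (Sum.inr i)) := by
  ext i
  by_cases h : i ∈ J
  · have : 𝒥.part i = J := 𝒥.part_eq_of_mem hJ h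
    simp [blockProj_apply, h, blockParam, this]
  · simp [blockProj_apply, h]

/-- The admissible parameters of `blockParam`. -/
def admissibleParam {n : ℕ} (𝒥 : Finpartition (Finset.univ : Finset (Fin n)))
    (ω : Finset (Fin n) → ℝ) (w : EuclideanSpace ℝ (Fin n)) :
    Set (Finset (Fin n) ⊕ Fin n → ℝ) :=
  {p | ∀ J ∈ 𝒥.parts, 0 ≤ p (Sum.inl J) ∧ (‖blockProj J w‖ < ω J → p (Sum.inl J) = 0) ∧
    (ω J ≠ 0 → ∀ i ∈ J, p (Sum.inr i) = 0)}

/-- Each constraint confines one coordinate to `[0, ∞)` or `{0}`, and such sets are intervals. This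
is why Hoffman's bound is needed in a form whose solution lies coordinatewise between the two given
points. -/
lemma admissibleParam_of_mem_uIcc {n : ℕ} {𝒥 : Finpartition (Finset.univ : Finset (Fin n))}
    {ω : Finset (Fin n) → ℝ} {w : EuclideanSpace ℝ (Fin n)} {p p₀ r : Finset (Fin n) ⊕ Fin n → ℝ}
    (hp : p ∈ admissibleParam 𝒥 ω w) (hp₀ : p₀ ∈ admissibleParam 𝒥 ω w)
    (hr : ∀ i, r i ∈ uIcc (p i) (p₀ i)) : r ∈ admissibleParam 𝒥 ω w := by
  intro J hJ
  obtain ⟨a1, a2, a3⟩ := hp J hJ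
  obtain ⟨b1, b2, b3⟩ := hp₀ J hJ
  refine ⟨?_, fun h => ?_, fun h i hi => ?_⟩
  · rcases mem_uIcc.1 (hr (Sum.inl J)) with h | h <;> linarith
  · have := hr (Sum.inl J)
    rw [a2 h, b2 h] at this
    simpa using this
  · have := hr (Sum.inr i)
    rw [a3 h i hi, b3 h i hi] at this
    simpa using this

/-- Blockwise: if `ω J = 0`, then `w` vanishes on `J` and so do both sides; otherwise the block is
`c • w_J` with `c ≥ 0`, and either `‖w_J‖ = ω J` or `c = 0`. -/
lemma groupLasso_blockParam {n : ℕ} {𝒥 : Finpartition (Finset.univ : Finset (Fin n))}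
    {ω : Finset (Fin n) → ℝ} {w : EuclideanSpace ℝ (Fin n)} {p : Finset (Fin n) ⊕ Fin n → ℝ}
    (hw : ∀ J ∈ 𝒥.parts, ‖blockProj J w‖ ≤ ω J) (hp : p ∈ admissibleParam 𝒥 ω w) :
    groupLasso 𝒥 ω (blockParam 𝒥 w p) = inner ℝ w (blockParam 𝒥 w p) := by
  rw [groupLasso_eq, ← sum_inner_blockProj 𝒥]
  refine Finset.sum_congr rfl fun J hJ => ?_
  obtain ⟨h1, h2, h3⟩ := hp J hJ
  rw [blockProj_blockParam 𝒥 w p hJ]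
  by_cases h0 : ω J = 0
  · have hwJ : blockProj J w = 0 := norm_le_zero_iff.1 (h0 ▸ hw J hJ)
    simp [h0, hwJ]
  · have hs : blockProj J (WithLp.toLp 2 fun i => p (Sum.inr i)) = 0 := by
      ext i
      by_cases hi : i ∈ J
      · simp [blockProj_apply, hi, h3 h0 i hi]
      · simp [blockProj_apply, hi]
    rw [hs, add_zero, norm_smul, inner_smul_right, real_inner_self_eq_norm_sq,
      Real.norm_of_nonneg h1]
    rcases (hw J hJ).lt_or_eq with h | h
    · simp [h2 h]
    · rw [h]; ring

/-- On a ball, the squared distance to the face of the group norm exposed by `w` is bounded by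
the gap `groupLasso x - ⟪w, x⟫`. -/
theorem exists_sq_norm_sub_blockParam_le {n : ℕ}
    {𝒥 : Finpartition (Finset.univ : Finset (Fin n))}
    {ω : Finset (Fin n) → ℝ} {w : EuclideanSpace ℝ (Fin n)} {R : ℝ}
    (hw : ∀ J ∈ 𝒥.parts, ‖blockProj J w‖ ≤ ω J) (hR : 0 ≤ R) :
    ∃ κ : ℝ, 0 ≤ κ ∧ ∀ x : EuclideanSpace ℝ (Fin n), ‖x‖ ≤ R →
      ∃ p ∈ admissibleParam 𝒥 ω w,
        ‖x - blockParam 𝒥 w p‖ ^ 2 ≤ κ * (groupLasso 𝒥 ω x - inner ℝ w x) := by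
  have h1 : ∀ J : Finset (Fin n), ∃ κ : ℝ, 0 ≤ κ ∧ (‖blockProj J w‖ ≤ ω J →
      ∀ x : EuclideanSpace ℝ (Fin n), ‖x‖ ≤ R →
      ‖x - ((if ‖blockProj J w‖ = ω J ∧ 0 < ω J then ‖x‖ / ω J else 0) • blockProj J w +
        (if ω J = 0 then x else 0))‖ ^ 2 ≤ κ * (ω J * ‖x‖ - inner ℝ (blockProj J w) x)) := by
    intro J
    by_cases h : ‖blockProj J w‖ ≤ ω J
    · obtain ⟨κ, h0, hκ⟩ := exists_sq_norm_sub_le_norm_sub_inner (blockProj J w) (ω J) R h hR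
      exact ⟨κ, h0, fun _ => hκ⟩
    · exact ⟨0, le_rfl, fun h' => absurd h' h⟩
  choose κ hκ0 hκ using h1
  refine ⟨∑ J ∈ 𝒥.parts, κ J, Finset.sum_nonneg fun J _ => hκ0 J, fun x hx => ?_⟩
  -- The single-block comparison points assembled: a coefficient on the blocks where `w` reaches the
  -- sphere, a copy of `x` on the unpenalized blocks.
  set p : Finset (Fin n) ⊕ Fin n → ℝ := Sum.elim
    (fun J => if ‖blockProj J w‖ = ω J ∧ 0 < ω J then ‖blockProj J x‖ / ω J else 0)
    (fun i => if ω (𝒥.part i) = 0 then x i else 0) with hp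
  refine ⟨p, fun J hJ => ⟨?_, fun h => ?_, fun h i hi => ?_⟩, ?_⟩
  · simp only [hp, Sum.elim_inl]
    split_ifs with h
    · have := h.2; positivity
    · exact le_rfl
  · simp [hp, h.ne]
  · simp [hp, 𝒥.part_eq_of_mem hJ hi, h]
  · rw [← sum_norm_blockProj_sq 𝒥, groupLasso_eq, ← sum_inner_blockProj 𝒥,
      ← Finset.sum_sub_distrib, Finset.mul_sum]
    refine Finset.sum_le_sum fun J hJ => ?_
    have hs : blockProj J (WithLp.toLp 2 fun i => p (Sum.inr i)) =
        if ω J = 0 then blockProj J x else 0 := by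
      ext i
      by_cases hi : i ∈ J
      · by_cases h0 : ω J = 0 <;>
          simp [blockProj_apply, hi, hp, 𝒥.part_eq_of_mem hJ hi, h0]
      · by_cases h0 : ω J = 0 <;> simp [blockProj_apply, hi, h0]
    have h2 := hκ J (hw J hJ) (blockProj J x) ((norm_blockProj_le J x).trans hx)
    rw [map_sub, blockProj_blockParam 𝒥 w p hJ, hs]
    refine h2.trans (mul_le_mul_of_nonneg_right
      (Finset.single_le_sum (fun J _ => hκ0 J) hJ) ?_)
    have := real_inner_le_norm (blockProj J w) (blockProj J x)
    have := mul_le_mul_of_nonneg_right (hw J hJ) (norm_nonneg (blockProj J x))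
    linarith

/-! ### Descent inequalities and linear convergence from quadratic growth -/

open Filter Topology

/-- Dividing by `t` and letting `t → 0+` removes the quadratic term; this extracts first-order
conditions from inequalities along segments. -/
lemma deriv_le_of_forall_le {ψ : ℝ → ℝ} {ψ' a b : ℝ} (hψ : HasDerivAt ψ ψ' 0)
    (h : ∀ t, 0 < t → t ≤ 1 → ψ t ≤ ψ 0 + t * a + t ^ 2 * b) : ψ' ≤ a := by
  have h1 := hψ.tendsto_slope_zero_right
  have h2 : Tendsto (fun t : ℝ => a + t * b) (𝓝[>] 0) (𝓝 (a + 0 * b)) :=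
    (Continuous.tendsto (by fun_prop) 0).mono_left nhdsWithin_le_nhds
  rw [zero_mul, add_zero] at h2
  refine le_of_tendsto_of_tendsto h1 h2 ?_
  filter_upwards [Ioc_mem_nhdsGT (zero_lt_one' ℝ)] with t ht
  have h3 := h t ht.1 ht.2
  have ht0 := ht.1
  rw [zero_add, smul_eq_mul, inv_mul_eq_div, div_le_iff₀ ht0]
  linarith

section InnerProduct

variable {E : Type*} [NormedAddCommGroup E] [InnerProductSpace ℝ E]

lemma norm_sq_segment (x z a : E) (t : ℝ) :
    ‖x + t • (z - x) - a‖ ^ 2 =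
      ‖x - a‖ ^ 2 + t * (‖z - a‖ ^ 2 - ‖x - a‖ ^ 2 - ‖z - x‖ ^ 2) + t ^ 2 * ‖z - x‖ ^ 2 := by
  have h1 : x + t • (z - x) - a = (x - a) + t • (z - x) := by abel
  have h2 : z - a = (x - a) + (z - x) := by abel
  rw [h1, h2, norm_add_sq_real, norm_add_sq_real, inner_smul_right, norm_smul, mul_pow,
    Real.norm_eq_abs, sq_abs]
  ring

lemma ConvexOn.le_segment {g : E → ℝ} {s : Set E} (hg : ConvexOn ℝ s g) {x z : E} (hx : x ∈ s)
    (hz : z ∈ s) {t : ℝ} (h0 : 0 ≤ t) (h1 : t ≤ 1) :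
    g (x + t • (z - x)) ≤ g x + t * (g z - g x) := by
  have := hg.2 hx hz (sub_nonneg.2 h1) h0 (sub_add_cancel 1 t)
  have e : (1 - t) • x + t • z = x + t • (z - x) := by module
  rw [e, smul_eq_mul, smul_eq_mul] at this
  linarith

/-- The proximal point minimizes a strongly convex function, hence with quadratic growth. -/
lemma prox_growth {g : E → ℝ} (hg : ConvexOn ℝ univ g) {γ : ℝ} {a x : E}
    (hx : x ∈ prox g γ a) (z : E) :
    g x + 1 / (2 * γ) * ‖x - a‖ ^ 2 + 1 / (2 * γ) * ‖z - x‖ ^ 2 ≤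
      g z + 1 / (2 * γ) * ‖z - a‖ ^ 2 := by
  -- With `ψ = 0` the conclusion is `0 ≤ a`, which is the claim.
  have h := deriv_le_of_forall_le (ψ := fun _ => 0) (ψ' := 0)
    (a := g z - g x + 1 / (2 * γ) * (‖z - a‖ ^ 2 - ‖x - a‖ ^ 2 - ‖z - x‖ ^ 2))
    (b := 1 / (2 * γ) * ‖z - x‖ ^ 2) (hasDerivAt_const _ _) fun t h0 h1 => by
      have h2 := hx (x + t • (z - x))
      have h3 := ConvexOn.le_segment hg (mem_univ x) (mem_univ z) h0.le h1
      rw [norm_sq_segment] at h2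
      linarith
  linarith

/-- The basic inequality of a proximal gradient step. -/
lemma prox_grad_step {f g : E → ℝ} {G : E → E} {L γ : ℝ} (hγ : 0 < γ) (hγL : γ < 1 / L)
    (hL : 0 < L) (hg : ConvexOn ℝ univ g)
    (hdesc : ∀ x y, f y ≤ f x + inner ℝ (G x) (y - x) + L / 2 * ‖y - x‖ ^ 2)
    (hconv : ∀ x y, f x + inner ℝ (G x) (y - x) ≤ f y)
    {x y : E} (hy : y ∈ prox g γ (x - γ • G x)) (z : E) :
    f y + g y + 1 / (2 * γ) * ‖z - y‖ ^ 2 ≤ f z + g z + 1 / (2 * γ) * ‖z - x‖ ^ 2 := by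
  have h1 := prox_growth hg hy z
  -- Expanding the square turns the proximal objective into the linearized one plus a constant
  -- independent of `u`.
  have e : ∀ u : E, 1 / (2 * γ) * ‖u - (x - γ • G x)‖ ^ 2 =
      1 / (2 * γ) * ‖u - x‖ ^ 2 + inner ℝ (G x) (u - x) + γ / 2 * ‖G x‖ ^ 2 := by
    intro u
    have e1 : u - (x - γ • G x) = (u - x) + γ • G x := by abel
    rw [e1, norm_add_sq_real, inner_smul_right, norm_smul, mul_pow, Real.norm_eq_abs, sq_abs,
      real_inner_comm]
    field_simp
  rw [e, e] at h1
  have h2 := hdesc x y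
  have h3 := hconv x z
  have h4 : L / 2 ≤ 1 / (2 * γ) := by
    rw [lt_div_iff₀ hL] at hγL
    rw [div_le_div_iff₀ two_pos (by positivity)]
    nlinarith
  have h5 := mul_le_mul_of_nonneg_right h4 (sq_nonneg ‖y - x‖)
  linarith

/-- Under quadratic growth on bounded sets, a method obeying the basic inequality converges
linearly. -/
theorem linear_convergence [CompleteSpace E] {F : E → ℝ} (hFc : Continuous F) {γ : ℝ}
    (hγ : 0 < γ) (hF : ConvexOn ℝ univ F) {x : ℕ → E}
    (hstep : ∀ k z, F (x (k + 1)) + 1 / (2 * γ) * ‖z - x (k + 1)‖ ^ 2 ≤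
      F z + 1 / (2 * γ) * ‖z - x k‖ ^ 2)
    {y₀ : E} (hy₀ : ∀ z, F y₀ ≤ F z)
    (hgrow : ∀ R : ℝ, ∃ c : ℝ, 0 < c ∧ ∀ u : E, ‖u‖ ≤ R →
      ∃ y : E, F y = F y₀ ∧ c * ‖u - y‖ ^ 2 ≤ F u - F y₀) :
    ∃ xbar : E, F xbar = F y₀ ∧ (∃ σ : ℝ, 0 < σ ∧ σ < 1 ∧ ∀ k,
      F (x (k + 1)) - F xbar ≤ σ * (F (x k) - F xbar)) ∧
      ∃ ρ₀ ρ : ℝ, 0 < ρ₀ ∧ 0 < ρ ∧ ρ < 1 ∧ ∀ k, ‖x k - xbar‖ ≤ ρ₀ * ρ ^ k := by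
  have hγ2 : 0 < 1 / (2 * γ) := by positivity
  have hfejer : ∀ k, ‖y₀ - x k‖ ≤ ‖y₀ - x 0‖ := by
    intro k
    induction k with
    | zero => exact le_rfl
    | succ k ih =>
      refine le_trans ?_ ih
      have h1 := hstep k y₀
      have h2 := hy₀ (x (k + 1))
      have h3 : 1 / (2 * γ) * ‖y₀ - x (k + 1)‖ ^ 2 ≤ 1 / (2 * γ) * ‖y₀ - x k‖ ^ 2 := by linarith
      exact (pow_le_pow_iff_left₀ (norm_nonneg _) (norm_nonneg _) two_ne_zero).1
        (le_of_mul_le_mul_left h3 hγ2)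
  have hbdd : ∀ k, ‖x k‖ ≤ ‖y₀‖ + ‖y₀ - x 0‖ := by
    intro k
    have h1 : x k = y₀ - (y₀ - x k) := by abel
    rw [h1]
    exact (norm_sub_le _ _).trans (by linarith [hfejer k])
  obtain ⟨c, hc, hcx⟩ := hgrow (‖y₀‖ + ‖y₀ - x 0‖)
  -- Moving a fraction `t` towards a minimizer gains `t` times the gap by convexity, and growth with
  -- `t ≤ γ * c` bounds the proximal cost by `t / 2` times the gap.
  set t : ℝ := min 1 (γ * c) with ht
  have ht0 : 0 < t := lt_min one_pos (mul_pos hγ hc)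
  have ht1 : t ≤ 1 := min_le_left _ _
  have ht2 : t ≤ γ * c := min_le_right _ _
  have hcontr : ∀ k, F (x (k + 1)) - F y₀ ≤ (1 - t / 2) * (F (x k) - F y₀) := by
    intro k
    obtain ⟨y, hy, hyc⟩ := hcx (x k) (hbdd k)
    have h1 := hstep k (x k + t • (y - x k))
    have h2 := ConvexOn.le_segment hF (mem_univ (x k)) (mem_univ y) ht0.le ht1
    have h3 : ‖x k + t • (y - x k) - x k‖ ^ 2 = t ^ 2 * ‖x k - y‖ ^ 2 := by
      rw [add_sub_cancel_left, norm_smul, mul_pow, Real.norm_eq_abs, sq_abs, norm_sub_rev]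
    rw [h3] at h1
    have h4 : 1 / (2 * γ) * (t ^ 2 * ‖x k - y‖ ^ 2) ≤ t / 2 * (F (x k) - F y₀) := by
      calc 1 / (2 * γ) * (t ^ 2 * ‖x k - y‖ ^ 2)
          = 1 / (2 * γ) * t * ‖x k - y‖ ^ 2 * t := by ring
        _ ≤ 1 / (2 * γ) * t * ‖x k - y‖ ^ 2 * (γ * c) := by gcongr
        _ = t / 2 * (c * ‖x k - y‖ ^ 2) := by field_simp
        _ ≤ _ := by gcongr
    have h5 : 0 ≤ 1 / (2 * γ) * ‖x k + t • (y - x k) - x (k + 1)‖ ^ 2 := by positivity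
    rw [hy] at h2
    linarith
  set σ : ℝ := 1 - t / 2 with hσ
  have hσ0 : 0 < σ := by linarith
  have hσ1 : σ < 1 := by linarith
  have hgap : ∀ k, F (x k) - F y₀ ≤ (F (x 0) - F y₀) * σ ^ k := by
    intro k
    induction k with
    | zero => simp
    | succ k ih =>
      calc _ ≤ σ * (F (x k) - F y₀) := hcontr k
        _ ≤ σ * ((F (x 0) - F y₀) * σ ^ k) := by gcongr
        _ = _ := by ring
  -- Squared step lengths are bounded by the gaps, so the steps shrink like the square root of `σ ^
  -- k`.
  set ρ : ℝ := Real.sqrt σ with hρ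
  have hρ0 : 0 < ρ := Real.sqrt_pos.2 hσ0
  have hρ1 : ρ < 1 := by
    rw [hρ, Real.sqrt_lt' one_pos]; simpa using hσ1
  set C : ℝ := Real.sqrt (2 * γ * (F (x 0) - F y₀)) with hC
  have hdist : ∀ k, dist (x k) (x (k + 1)) ≤ C * ρ ^ k := by
    intro k
    have h1 := hstep k (x k)
    rw [sub_self, norm_zero] at h1
    have h2 := hy₀ (x (k + 1))
    have h3 : 1 / (2 * γ) * ‖x k - x (k + 1)‖ ^ 2 ≤ (F (x 0) - F y₀) * σ ^ k := by
      linarith [hgap k]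
    rw [one_div, inv_mul_le_iff₀ (by positivity)] at h3
    have h4 : ρ ^ k = Real.sqrt (σ ^ k) := by
      rw [hρ]
      refine (Real.sqrt_eq_iff_eq_sq (by positivity) (by positivity)).2 ?_ |>.symm
      rw [← pow_mul, mul_comm, pow_mul, Real.sq_sqrt hσ0.le]
    rw [dist_eq_norm, h4, hC, ← Real.sqrt_mul (by nlinarith [hy₀ (x 0)])]
    refine Real.le_sqrt_of_sq_le ?_
    linarith
  obtain ⟨xbar, hlim⟩ := cauchySeq_tendsto_of_complete (cauchySeq_of_le_geometric ρ C hρ1 hdist)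
  have hFlim : Tendsto (fun k => F (x k)) atTop (𝓝 (F xbar)) := (hFc.tendsto xbar).comp hlim
  have hbound : Tendsto (fun k : ℕ => (F (x 0) - F y₀) * σ ^ k + F y₀) atTop
      (𝓝 ((F (x 0) - F y₀) * 0 + F y₀)) :=
    ((tendsto_pow_atTop_nhds_zero_of_lt_one hσ0.le hσ1).const_mul _).add_const _
  rw [mul_zero, zero_add] at hbound
  have hxbar : F xbar = F y₀ := le_antisymm
    (le_of_tendsto_of_tendsto' hFlim hbound fun k => by linarith [hgap k]) (hy₀ xbar)
  refine ⟨xbar, hxbar, ⟨σ, hσ0, hσ1, fun k => hxbar ▸ hcontr k⟩, C / (1 - ρ) + 1, ρ, ?_, hρ0, hρ1,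
    fun k => ?_⟩
  · have : 0 ≤ C / (1 - ρ) := div_nonneg (Real.sqrt_nonneg _) (by linarith)
    linarith
  · have h1 := dist_le_of_le_geometric_of_tendsto ρ C hρ1 hdist hlim k
    rw [dist_eq_norm] at h1
    have h2 : C * ρ ^ k / (1 - ρ) = C / (1 - ρ) * ρ ^ k := by ring
    rw [h2] at h1
    have h3 : 0 < ρ ^ k := pow_pos hρ0 k
    linarith

lemma HasGradientAt.hasDerivAt_segment [CompleteSpace E] {φ : E → ℝ} {v x d : E} {t : ℝ}
    (h : HasGradientAt φ v (x + t • d)) :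
    HasDerivAt (fun s : ℝ => φ (x + s • d)) (inner ℝ v d) t := by
  have h1 : HasDerivAt (fun s : ℝ => x + s • d) d t := by
    simpa using ((hasDerivAt_id t).smul_const d).const_add x
  have h2 := h.hasFDerivAt.comp_hasDerivAt t h1
  exact h2.congr_deriv (by simp)

/-- The descent lemma on a convex set. -/
lemma descent_of_lipschitz_gradient [CompleteSpace E] {φ : E → ℝ} {G : E → E} {s : Set E} {L : ℝ}
    (hs : Convex ℝ s) (hG : ∀ x ∈ s, HasGradientAt φ (G x) x)
    (hL : ∀ x ∈ s, ∀ y ∈ s, ‖G x - G y‖ ≤ L * ‖x - y‖) {x y : E} (hx : x ∈ s) (hy : y ∈ s) :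
    φ y ≤ φ x + inner ℝ (G x) (y - x) + L / 2 * ‖y - x‖ ^ 2 := by
  set d := y - x with hd
  have hseg : ∀ t ∈ Icc (0 : ℝ) 1, x + t • d ∈ s := fun t ht => hs.add_smul_sub_mem hx hy ht
  have hder : ∀ t ∈ Icc (0 : ℝ) 1,
      HasDerivAt (fun t : ℝ => φ (x + t • d)) (inner ℝ (G (x + t • d)) d) t :=
    fun t ht => HasGradientAt.hasDerivAt_segment (hG _ (hseg t ht))
  have hB : ∀ t : ℝ, HasDerivAt
      (fun t : ℝ => φ x + t * inner ℝ (G x) d + L / 2 * ‖d‖ ^ 2 * t ^ 2)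
      (inner ℝ (G x) d + L * ‖d‖ ^ 2 * t) t := by
    intro t
    have h1 := (((hasDerivAt_id t).mul_const (inner ℝ (G x) d)).const_add (φ x)).add
      ((hasDerivAt_pow 2 t).const_mul (L / 2 * ‖d‖ ^ 2))
    refine h1.congr_deriv ?_
    norm_num
    ring
  have key := image_le_of_deriv_right_le_deriv_boundary
    (f := fun t : ℝ => φ (x + t • d)) (a := 0) (b := 1)
    (fun t ht => (hder t ht).continuousAt.continuousWithinAt)
    (fun t ht => (hder t ⟨ht.1, ht.2.le⟩).hasDerivWithinAt)
    (B := fun t : ℝ => φ x + t * inner ℝ (G x) d + L / 2 * ‖d‖ ^ 2 * t ^ 2) (by simp)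
    (fun t _ => (hB t).continuousAt.continuousWithinAt)
    (fun t _ => (hB t).hasDerivWithinAt)
    (fun t ht => by
      have h1 : inner ℝ (G (x + t • d) - G x) d ≤ L * ‖d‖ ^ 2 * t := by
        have h2 := hL _ (hseg t ⟨ht.1, ht.2.le⟩) _ hx
        rw [add_sub_cancel_left, norm_smul, Real.norm_of_nonneg ht.1] at h2
        calc _ ≤ ‖G (x + t • d) - G x‖ * ‖d‖ := real_inner_le_norm _ _
          _ ≤ L * (t * ‖d‖) * ‖d‖ := by gcongr
          _ = _ := by ring
      rw [inner_sub_left] at h1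
      linarith)
  have h1 := key (right_mem_Icc.2 zero_le_one)
  simp only [one_smul, one_mul, one_pow, mul_one] at h1
  rwa [hd, add_sub_cancel, ← hd] at h1

end InnerProduct

/-! ### Quadratic growth of the composite objective -/

/-- Local strong convexity of the outer function gives a strengthened gradient inequality for the
composite function on balls. -/
lemma exists_gradient_inequality {m n : ℕ}
    {A : EuclideanSpace ℝ (Fin n) →L[ℝ] EuclideanSpace ℝ (Fin m)} {q : EuclideanSpace ℝ (Fin n)}
    {h : EuclideanSpace ℝ (Fin m) → ℝ} {D : Set (EuclideanSpace ℝ (Fin m))} (hD : ∀ x, A x ∈ D)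
    (hh : ∀ K ⊆ D, IsCompact K → Convex ℝ K → ∃ c : ℝ, 0 < c ∧ StrongConvexOn K c h)
    {f : EuclideanSpace ℝ (Fin n) → ℝ} (hf : ∀ x, f x = h (A x) + inner ℝ q x)
    {G : EuclideanSpace ℝ (Fin n) → EuclideanSpace ℝ (Fin n)}
    (hG : ∀ x, HasGradientAt f (G x) x) (R : ℝ) :
    ∃ c : ℝ, 0 < c ∧ ∀ x y, ‖x‖ ≤ R → ‖y‖ ≤ R →
      f x + inner ℝ (G x) (y - x) + c * ‖A (y - x)‖ ^ 2 ≤ f y := by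
  have hsub : A '' Metric.closedBall 0 R ⊆ D := by
    rintro _ ⟨x, -, rfl⟩
    exact hD x
  obtain ⟨c, hc, hK⟩ := hh (A '' Metric.closedBall 0 R) hsub
    ((isCompact_closedBall 0 R).image A.continuous)
    ((convex_closedBall 0 R).linear_image A.toLinearMap)
  refine ⟨c / 2, by positivity, fun x y hx hy => ?_⟩
  have h1 := deriv_le_of_forall_le (ψ := fun t : ℝ => f (x + t • (y - x)))
    (ψ' := inner ℝ (G x) (y - x)) (a := f y - f x - c / 2 * ‖A (y - x)‖ ^ 2)
    (b := c / 2 * ‖A (y - x)‖ ^ 2)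
    (HasGradientAt.hasDerivAt_segment (by simpa using hG x)) fun t h0 h1 => by
      have h2 := hK.2 (mem_image_of_mem A (mem_closedBall_zero_iff.2 hx))
        (mem_image_of_mem A (mem_closedBall_zero_iff.2 hy)) (sub_nonneg.2 h1) h0.le
        (sub_add_cancel 1 t)
      have e1 : (1 - t) • A x + t • A y = A (x + t • (y - x)) := by
        simp only [map_add, map_smul, map_sub]; module
      have e2 : ‖A x - A y‖ = ‖A (y - x)‖ := by rw [map_sub, norm_sub_rev]
      rw [e1, e2, smul_eq_mul, smul_eq_mul] at h2
      have e3 : inner ℝ q (x + t • (y - x)) = inner ℝ q x + t * (inner ℝ q y - inner ℝ q x) := by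
        rw [inner_add_right, inner_smul_right, inner_sub_right]
      simp only [zero_smul, add_zero]
      rw [hf, hf x, hf y, e3]
      linarith
  linarith

/-- Quadratic growth on bounded sets of a locally strongly convex composite function plus a group
lasso penalty. -/
theorem exists_quadratic_growth {m n : ℕ}
    {A : EuclideanSpace ℝ (Fin n) →L[ℝ] EuclideanSpace ℝ (Fin m)} {q : EuclideanSpace ℝ (Fin n)}
    {h : EuclideanSpace ℝ (Fin m) → ℝ} {D : Set (EuclideanSpace ℝ (Fin m))} (hD : ∀ x, A x ∈ D)
    (hh : ∀ K ⊆ D, IsCompact K → Convex ℝ K → ∃ c : ℝ, 0 < c ∧ StrongConvexOn K c h)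
    {f : EuclideanSpace ℝ (Fin n) → ℝ} (hf : ∀ x, f x = h (A x) + inner ℝ q x)
    {G : EuclideanSpace ℝ (Fin n) → EuclideanSpace ℝ (Fin n)}
    (hG : ∀ x, HasGradientAt f (G x) x)
    {𝒥 : Finpartition (Finset.univ : Finset (Fin n))} {ω : Finset (Fin n) → ℝ}
    (hω : ∀ J ∈ 𝒥.parts, 0 ≤ ω J) {x₀ : EuclideanSpace ℝ (Fin n)}
    (hx₀ : ∀ z, f x₀ + groupLasso 𝒥 ω x₀ ≤ f z + groupLasso 𝒥 ω z) (R : ℝ) :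
    ∃ c : ℝ, 0 < c ∧ ∀ u, ‖u‖ ≤ R → ∃ y,
      f y + groupLasso 𝒥 ω y = f x₀ + groupLasso 𝒥 ω x₀ ∧
      c * ‖u - y‖ ^ 2 ≤ f u + groupLasso 𝒥 ω u - (f x₀ + groupLasso 𝒥 ω x₀) := by
  set g := groupLasso 𝒥 ω with hg
  have hgc : ConvexOn ℝ univ g := groupLasso_convexOn 𝒥 ω hω
  set w := -G x₀ with hw
  have hGd : ∀ d, HasDerivAt (fun t : ℝ => f (x₀ + t • d)) (inner ℝ (G x₀) d) 0 :=
    fun d => HasGradientAt.hasDerivAt_segment (by simpa using hG x₀)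
  have hsub : ∀ z, inner ℝ w (z - x₀) ≤ g z - g x₀ := by
    intro z
    refine deriv_le_of_forall_le (b := 0) (ψ := fun t : ℝ => -f (x₀ + t • (z - x₀)))
      (by rw [hw, inner_neg_left]; exact (hGd _).neg) fun t h0 h1 => ?_
    have h2 := hx₀ (x₀ + t • (z - x₀))
    have h3 := ConvexOn.le_segment hgc (mem_univ x₀) (mem_univ z) h0.le h1
    simp only [zero_smul, add_zero]
    linarith
  -- Positive homogeneity: the subgradient inequality at `0` and at `2 • x₀` gives the two bounds.
  have hg0 : g x₀ = inner ℝ w x₀ := by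
    have h1 := hsub 0
    have h2 := hsub ((2 : ℝ) • x₀)
    have e1 : g 0 = 0 := by simpa using groupLasso_smul 𝒥 ω 0 0
    have e2 : g ((2 : ℝ) • x₀) = 2 * g x₀ := by
      rw [hg, groupLasso_smul, abs_of_pos two_pos]
    rw [e1, zero_sub, inner_neg_right] at h1
    rw [e2, inner_sub_right, inner_smul_right] at h2
    linarith
  have hwz : ∀ z, inner ℝ w z ≤ g z := by
    intro z
    have := hsub z
    rw [inner_sub_right] at this
    linarith
  have hwJ : ∀ J ∈ 𝒥.parts, ‖blockProj J w‖ ≤ ω J :=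
    fun J hJ => norm_blockProj_le_of_inner_le hω hwz hJ
  have hsol : ∀ y, A y = A x₀ → g y = inner ℝ w y → f y + g y = f x₀ + g x₀ := by
    intro y hy hgy
    -- Since `A y = A x₀`, `f` is affine along this line with slope given by `q`.
    have h1 : inner ℝ (G x₀) (y - x₀) = inner ℝ q (y - x₀) := by
      refine (hGd (y - x₀)).unique ?_
      have e : (fun t : ℝ => f (x₀ + t • (y - x₀))) =
          fun t : ℝ => f x₀ + t * inner ℝ q (y - x₀) := by
        funext t
        rw [hf, hf x₀, inner_add_right, inner_smul_right, map_add, map_smul, map_sub, hy, sub_self,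
          smul_zero, add_zero]
        ring
      rw [e]
      simpa using ((hasDerivAt_id (0 : ℝ)).mul_const (inner ℝ q (y - x₀))).const_add (f x₀)
    have h2 : inner ℝ w y - inner ℝ w x₀ = -inner ℝ q (y - x₀) := by
      rw [← inner_sub_right, hw, inner_neg_left, h1]
    rw [inner_sub_right] at h2
    rw [hgy, hg0, hf, hf x₀, hy]
    linarith
  set R' := max R ‖x₀‖ with hR'
  have hR0 : 0 ≤ R' := (norm_nonneg x₀).trans (le_max_right _ _)
  obtain ⟨c, hc, hcx⟩ := exists_gradient_inequality hD hh hf hG R'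
  obtain ⟨κ, hκ0, hκ⟩ := exists_sq_norm_sub_blockParam_le hwJ hR0
  obtain ⟨η, hη0, hη⟩ := hoffman_box (A.toLinearMap ∘ₗ blockParam 𝒥 w)
  set B := LinearMap.toContinuousLinearMap (blockParam 𝒥 w) with hB
  -- The gap vanishes at `x₀`, so `x₀` is itself parametrized, by `p₀`.
  obtain ⟨p₀, hp₀, hxp₀⟩ := hκ x₀ (le_max_right _ _)
  rw [← hg, hg0, sub_self, mul_zero] at hxp₀
  have hx₀p : blockParam 𝒥 w p₀ = x₀ := by
    have : ‖x₀ - blockParam 𝒥 w p₀‖ = 0 := by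
      have := sq_nonneg ‖x₀ - blockParam 𝒥 w p₀‖
      exact pow_eq_zero_iff two_ne_zero |>.1 (le_antisymm hxp₀ this)
    exact (sub_eq_zero.1 (norm_eq_zero.1 this)).symm
  set k₁ := 1 + ‖B‖ * η * ‖A‖ with hk₁
  set k₂ := ‖B‖ * η with hk₂
  set K := 2 * k₁ ^ 2 * κ + 2 * k₂ ^ 2 / c + 1 with hK
  have hKpos : 0 < K := by positivity
  refine ⟨K⁻¹, by positivity, fun u hu => ?_⟩
  have hu' : ‖u‖ ≤ R' := hu.trans (le_max_left _ _)
  obtain ⟨p, hp, hup⟩ := hκ u hu'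
  obtain ⟨r, hr1, hr2, hr3⟩ := hη p p₀
  simp only [LinearMap.comp_apply, hx₀p, ContinuousLinearMap.coe_coe] at hr1 hr3
  have hr := admissibleParam_of_mem_uIcc hp hp₀ hr2
  refine ⟨blockParam 𝒥 w r, hsol _ hr1 (groupLasso_blockParam hwJ hr), ?_⟩
  set a := ‖u - blockParam 𝒥 w p‖ with ha
  set b := ‖A (u - x₀)‖ with hb
  have h1 : ‖A (blockParam 𝒥 w p) - A x₀‖ ≤ b + ‖A‖ * a := by
    have e : A (blockParam 𝒥 w p) - A x₀ = A (u - x₀) - A (u - blockParam 𝒥 w p) := by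
      simp only [map_sub]; abel
    rw [e]
    exact (norm_sub_le _ _).trans (add_le_add le_rfl (A.le_opNorm _))
  have h2 : ‖blockParam 𝒥 w p - blockParam 𝒥 w r‖ ≤ ‖B‖ * ‖p - r‖ := by
    rw [← map_sub]
    exact B.le_opNorm (p - r)
  have h3 : ‖u - blockParam 𝒥 w r‖ ≤ k₁ * a + k₂ * b := by
    calc ‖u - blockParam 𝒥 w r‖ ≤ a + ‖blockParam 𝒥 w p - blockParam 𝒥 w r‖ :=
          norm_sub_le_norm_sub_add_norm_sub _ _ _
      _ ≤ a + ‖B‖ * (η * (b + ‖A‖ * a)) := by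
          gcongr
          refine h2.trans ?_
          gcongr
          exact hr3.trans (by gcongr)
      _ = _ := by rw [hk₁, hk₂]; ring
  have h4 : ‖u - blockParam 𝒥 w r‖ ^ 2 ≤ 2 * k₁ ^ 2 * a ^ 2 + 2 * k₂ ^ 2 * b ^ 2 := by
    calc ‖u - blockParam 𝒥 w r‖ ^ 2 ≤ (k₁ * a + k₂ * b) ^ 2 := by gcongr
      _ ≤ _ := by linarith [sq_nonneg (k₁ * a - k₂ * b)]
  have h5 := hcx x₀ u (le_max_right _ _) hu'
  have h6 := hwz u
  -- The objective gap splits into the two residuals: distance to the face and mismatch under `A`.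
  have h7 : (g u - inner ℝ w u) + c * b ^ 2 ≤ f u + g u - (f x₀ + g x₀) := by
    have : inner ℝ w (u - x₀) = -inner ℝ (G x₀) (u - x₀) := by rw [hw, inner_neg_left]
    rw [inner_sub_right] at this
    linarith
  have h8 : 0 ≤ c * b ^ 2 := by positivity
  rw [inv_mul_le_iff₀ hKpos]
  calc ‖u - blockParam 𝒥 w r‖ ^ 2
      ≤ 2 * k₁ ^ 2 * (κ * (g u - inner ℝ w u)) + 2 * k₂ ^ 2 * b ^ 2 := by
        refine h4.trans ?_
        gcongr
    _ = 2 * k₁ ^ 2 * κ * (g u - inner ℝ w u) + 2 * k₂ ^ 2 / c * (c * b ^ 2) := by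
        field_simp
    _ ≤ K * (g u - inner ℝ w u) + K * (c * b ^ 2) := by
        have e1 : 0 ≤ 2 * k₁ ^ 2 * κ := by positivity
        have e2 : 0 ≤ 2 * k₂ ^ 2 / c := by positivity
        refine add_le_add (mul_le_mul_of_nonneg_right ?_ (by linarith))
          (mul_le_mul_of_nonneg_right ?_ h8) <;> linarith
    _ = K * (g u - inner ℝ w u + c * b ^ 2) := by ring
    _ ≤ _ := by gcongr

/-! ### Passage from extended-real to real values; finiteness of `f` -/

lemma coe_toReal_of_mem_effDom {E : Type*} {φ : E → EReal} (hφ : Proper φ) {x : E}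
    (hx : x ∈ effDom φ) : ((φ x).toReal : EReal) = φ x :=
  EReal.coe_toReal hx.ne (hφ.1 x)

lemma ConvexFun.convexOn_toReal {E : Type*} [AddCommGroup E] [Module ℝ E] {φ : E → EReal}
    (hc : ConvexFun φ) (hφ : Proper φ) : ConvexOn ℝ (effDom φ) fun x => (φ x).toReal := by
  have key : ∀ x ∈ effDom φ, ∀ y ∈ effDom φ, ∀ a b : ℝ, 0 ≤ a → 0 ≤ b → a + b = 1 →
      φ (a • x + b • y) ≤ ((a * (φ x).toReal + b * (φ y).toReal : ℝ) : EReal) := by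
    intro x hx y hy a b ha hb hab
    exact hc (x := (x, (φ x).toReal)) (y := (y, (φ y).toReal))
      (coe_toReal_of_mem_effDom hφ hx).ge (coe_toReal_of_mem_effDom hφ hy).ge ha hb hab
  have hdom : Convex ℝ (effDom φ) := fun x hx y hy a b ha hb hab =>
    (key x hx y hy a b ha hb hab).trans_lt (EReal.coe_lt_top _)
  refine ⟨hdom, fun x hx y hy a b ha hb hab => ?_⟩
  have h1 := key x hx y hy a b ha hb hab
  rw [← coe_toReal_of_mem_effDom hφ (hdom hx hy ha hb hab)] at h1
  exact EReal.coe_le_coe_iff.1 h1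

section Structured

variable {m n : ℕ} {h : EuclideanSpace ℝ (Fin m) → EReal}
  {A : EuclideanSpace ℝ (Fin n) →L[ℝ] EuclideanSpace ℝ (Fin m)} {q : EuclideanSpace ℝ (Fin n)}
  {f : EuclideanSpace ℝ (Fin n) → EReal}

lemma mem_effDom_comp_add_iff (hf : ∀ x, f x = h (A x) + ((inner ℝ q x : ℝ) : EReal))
    (x : EuclideanSpace ℝ (Fin n)) : x ∈ effDom f ↔ A x ∈ effDom h := by
  simp only [effDom, mem_ofPred_eq, hf]
  constructor
  · intro hx
    by_contra hA
    rw [not_lt_top_iff.1 hA, EReal.top_add_coe] at hx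
    exact lt_irrefl _ hx
  · intro hx
    exact EReal.add_lt_top hx.ne (EReal.coe_ne_top _)

lemma toReal_comp_add (hh : Proper h)
    (hf : ∀ x, f x = h (A x) + ((inner ℝ q x : ℝ) : EReal))
    {x : EuclideanSpace ℝ (Fin n)} (hx : A x ∈ effDom h) :
    (f x).toReal = (h (A x)).toReal + inner ℝ q x := by
  rw [hf, EReal.toReal_add hx.ne (hh.1 _) (EReal.coe_ne_top _) (EReal.coe_ne_bot _),
    EReal.toReal_coe]

lemma hasGradientAt_comp_add (hh : LocallyStronglyConvex h)
    (hf : ∀ x, f x = h (A x) + ((inner ℝ q x : ℝ) : EReal))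
    {x : EuclideanSpace ℝ (Fin n)} (hx : A x ∈ effDom h) :
    HasGradientAt (fun z => (f z).toReal) (grad f x) x := by
  refine DifferentiableAt.hasGradientAt ?_
  have h1 : DifferentiableAt ℝ (fun y => (h y).toReal) (A x) :=
    (hh.contDiffOn.differentiableOn one_ne_zero).differentiableAt (hh.isOpen_dom.mem_nhds hx)
  have h2 : DifferentiableAt ℝ (fun z => (h (A z)).toReal + inner ℝ q z) x :=
    (DifferentiableAt.comp x h1 A.differentiableAt).add
      ((innerSL ℝ q).differentiableAt)
  refine h2.congr_of_eventuallyEq ?_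
  filter_upwards [(hh.isOpen_dom.preimage A.continuous).mem_nhds hx] with z hz
  exact toReal_comp_add hh.proper hf hz

/-- A lower semicontinuous composite function whose gradient is Lipschitz on its open domain is
finite everywhere. -/
lemma effDom_eq_univ (hh : LocallyStronglyConvex h)
    (hf : ∀ x, f x = h (A x) + ((inner ℝ q x : ℝ) : EReal)) (hfp : (effDom f).Nonempty) {L : ℝ}
    (hlip : ∀ x ∈ effDom f, ∀ y ∈ effDom f, ‖grad f x - grad f y‖ ≤ L * ‖x - y‖) :
    effDom f = univ := by
  have hpre : effDom f = A ⁻¹' effDom h := by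
    ext x
    exact mem_effDom_comp_add_iff hf x
  have hopen : IsOpen (effDom f) := hpre ▸ hh.isOpen_dom.preimage A.continuous
  have hconv : Convex ℝ (effDom f) :=
    hpre ▸ (hh.convex.convexOn_toReal hh.proper).1.linear_preimage A.toLinearMap
  refine IsClopen.eq_univ ⟨isClosed_of_closure_subset fun x hx => ?_, hopen⟩ hfp
  obtain ⟨x₀, hx₀⟩ := hfp
  by_contra hxd
  -- A continuous bound for `h ∘ A` on the domain, from the descent lemma. At a limit point `x`
  -- outside the domain `h (A x) = ⊤`, so lower semicontinuity makes `h ∘ A` exceed `b x + 1`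
  -- nearby, a contradiction.
  set b : EuclideanSpace ℝ (Fin n) → ℝ := fun y => (f x₀).toReal + inner ℝ (grad f x₀) (y - x₀) +
    L / 2 * ‖y - x₀‖ ^ 2 - inner ℝ q y with hb
  have hbc : Continuous b := by fun_prop
  have hle : ∀ y ∈ effDom f, h (A y) ≤ (b y : EReal) := by
    intro y hy
    have hy' := (mem_effDom_comp_add_iff hf y).1 hy
    have h1 := descent_of_lipschitz_gradient hconv
      (fun z hz => hasGradientAt_comp_add hh hf ((mem_effDom_comp_add_iff hf z).1 hz))
      hlip hx₀ hy
    rw [toReal_comp_add hh.proper hf hy'] at h1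
    rw [← coe_toReal_of_mem_effDom hh.proper hy']
    exact EReal.coe_le_coe_iff.2 (by simp only [hb]; linarith)
  have hAx : h (A x) = ⊤ :=
    not_lt_top_iff.1 fun hA => hxd ((mem_effDom_comp_add_iff hf x).2 hA)
  have h1 : ∀ᶠ y in 𝓝 x, ((b x + 1 : ℝ) : EReal) < h (A y) :=
    A.continuous.continuousAt.eventually
      (hh.closed (A x) _ (by show _ < h (A x); rw [hAx]; exact EReal.coe_lt_top _))
  have h2 : ∀ᶠ y in 𝓝 x, b y < b x + 1 := hbc.continuousAt.eventually_lt_const (by linarith)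
  obtain ⟨y, hy, hy1, hy2⟩ := ((mem_closure_iff_frequently.1 hx).and_eventually (h1.and h2)).exists
  have h3 := hy1.trans_le (hle y hy)
  exact absurd (EReal.coe_lt_coe_iff.1 h3) (by linarith)

end Structured

end ProxGrad

/-! ### Assembly -/

theorem proposition5p1 {m n : ℕ}
    (A : Matrix (Fin m) (Fin n) ℝ) (q : EuclideanSpace ℝ (Fin n))
    (h : EuclideanSpace ℝ (Fin m) → EReal) (hh : ProxGrad.LocallyStronglyConvex h)
    (f : EuclideanSpace ℝ (Fin n) → EReal) (hf : f = ProxGrad.structuredFun h A q)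
    (hfproper : ProxGrad.Proper f)
    (L : ℝ) (hL : 0 < L)
    (hlip : ∀ x ∈ ProxGrad.effDom f, ∀ y ∈ ProxGrad.effDom f,
      ‖ProxGrad.grad f x - ProxGrad.grad f y‖ ≤ L * ‖x - y‖)
    (𝒥 : Finpartition (Finset.univ : Finset (Fin n))) (ω : Finset (Fin n) → ℝ)
    (hω : ∀ J ∈ 𝒥.parts, 0 ≤ ω J)
    (g : EuclideanSpace ℝ (Fin n) → ℝ) (hg : g = ProxGrad.groupLasso 𝒥 ω)
    (F : EuclideanSpace ℝ (Fin n) → EReal) (hF : F = fun x => f x + (g x : EReal))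
    (hopt : (ProxGrad.optSet F).Nonempty)
    (γ : ℝ) (hγ : 0 < γ) (hγL : γ < 1 / L)
    (x : ℕ → EuclideanSpace ℝ (Fin n)) (hx : ProxGrad.IsPGSequence f g γ x) :
    ∃ xbar ∈ ProxGrad.optSet F, ProxGrad.ConvergesLinearly F x xbar := by
  set T : EuclideanSpace ℝ (Fin n) →L[ℝ] EuclideanSpace ℝ (Fin m) :=
    LinearMap.toContinuousLinearMap (Matrix.toEuclideanLin A) with hT
  have hfT : ∀ z, f z = h (T z) + ((inner ℝ q z : ℝ) : EReal) := fun z => by rw [hf]; rfl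
  have huniv := ProxGrad.effDom_eq_univ hh hfT hfproper.2 hlip
  have hdomf : ∀ z, z ∈ ProxGrad.effDom f := fun z => huniv ▸ Set.mem_univ z
  have hdom : ∀ z, T z ∈ ProxGrad.effDom h :=
    fun z => (ProxGrad.mem_effDom_comp_add_iff hfT z).1 (hdomf z)
  set φ : EuclideanSpace ℝ (Fin n) → ℝ := fun z => (f z).toReal with hφ
  have hφT : ∀ z, φ z = (h (T z)).toReal + inner ℝ q z :=
    fun z => ProxGrad.toReal_comp_add hh.proper hfT (hdom z)
  have hG : ∀ z, HasGradientAt φ (ProxGrad.grad f z) z :=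
    fun z => ProxGrad.hasGradientAt_comp_add hh hfT (hdom z)
  have hFφ : ∀ z, F z = ((φ z + g z : ℝ) : EReal) := fun z => by
    rw [hF, EReal.coe_add, hφ, ProxGrad.coe_toReal_of_mem_effDom hfproper (hdomf z)]
  have hgconv : ConvexOn ℝ Set.univ g := hg ▸ ProxGrad.groupLasso_convexOn 𝒥 ω hω
  have hlower : ∀ y z, φ y + inner ℝ (ProxGrad.grad f y) (z - y) ≤ φ z := by
    intro y z
    -- The radius only has to contain the two given points, since the term with `c` is dropped.
    obtain ⟨c, hc, hcx⟩ := ProxGrad.exists_gradient_inequality hdom hh.strongConvexOn hφT hG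
      (max ‖y‖ ‖z‖)
    have h1 := hcx y z (le_max_left _ _) (le_max_right _ _)
    have h2 : 0 ≤ c * ‖T (z - y)‖ ^ 2 := by positivity
    linarith
  have hφconv : ConvexOn ℝ Set.univ φ := by
    have h1 := (hh.convex.convexOn_toReal hh.proper).comp_linearMap T.toLinearMap
    have h2 : ConvexOn ℝ Set.univ fun z => (h (T z)).toReal :=
      h1.subset (fun z _ => hdom z) convex_univ
    have h3 := h2.add ((innerSL ℝ q).toLinearMap.convexOn convex_univ)
    exact h3.congr fun z _ => (hφT z).symm
  have hstep : ∀ k z, φ (x (k + 1)) + g (x (k + 1)) + 1 / (2 * γ) * ‖z - x (k + 1)‖ ^ 2 ≤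
      φ z + g z + 1 / (2 * γ) * ‖z - x k‖ ^ 2 := fun k z =>
    ProxGrad.prox_grad_step hγ hγL hL hgconv
      (fun y z => ProxGrad.descent_of_lipschitz_gradient convex_univ (fun z _ => hG z)
        (fun y _ z _ => hlip y (hdomf y) z (hdomf z)) (Set.mem_univ y) (Set.mem_univ z))
      hlower (hx k) z
  obtain ⟨x₀, hx₀⟩ := hopt
  have hx₀' : ∀ z, φ x₀ + g x₀ ≤ φ z + g z := fun z => by
    have h1 := hx₀ z
    rw [hFφ, hFφ] at h1
    exact EReal.coe_le_coe_iff.1 h1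
  have hcont : Continuous fun z => φ z + g z :=
    (continuous_iff_continuousAt.2 fun z => (hG z).continuousAt).add
      (hg ▸ ProxGrad.continuous_groupLasso 𝒥 ω)
  obtain ⟨xbar, hxbar, ⟨σ, hσ0, hσ1, hσ⟩, hρ⟩ :=
    ProxGrad.linear_convergence (F := fun z => φ z + g z) hcont hγ (hφconv.add hgconv) hstep hx₀'
      (by
        subst hg
        exact ProxGrad.exists_quadratic_growth hdom hh.strongConvexOn hφT hG hω hx₀')
  -- `k₀ = 0` works because the growth constant is valid on a ball containing all iterates.
  refine ⟨xbar, fun z => ?_, 0, ⟨σ, hσ0, hσ1, fun k _ => ?_⟩, ?_⟩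
  · rw [hFφ, hFφ, EReal.coe_le_coe_iff]
    exact hxbar.trans_le (hx₀' z)
  · rw [hFφ, hFφ, hFφ, ← EReal.coe_sub, ← EReal.coe_sub, ← EReal.coe_mul, EReal.coe_le_coe_iff]
    exact hσ k
  · obtain ⟨ρ₀, ρ, h1, h2, h3, h4⟩ := hρ
    exact ⟨ρ₀, ρ, h1, h2, h3, fun k _ => h4 k⟩
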